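/- Let $n\ge 1$, $d\ge 2$ and $1\le m<d$ be integers and let $\nu\ge 0$, $c>0$, $t>0$ be real. Let $(\tau_1,\dots,\tau_n)$ be a random vector with the rescaled Dirichlet density $$f_{d,\nu}(\tau_1,\dots,\tau_n)=\frac{\Gamma((n+1)(2\nu+d-1))}{\Gamma(2\nu+d-1)^{n+1}}\,\frac{\prod_{k=1}^{n+1}\tau_k^{2\nu+d-2}}{t^{(n+1)(2\nu+d-1)-1}},\qquad \tau_{n+1}:=t-\sum_{k=1}^n\tau_k,$$ on $\{\tau_1,\dots,\tau_n>0,\ \tau_1+\dots+\tau_n<t\}$. For $k=1,\dots,n+1$ let $(\theta_{1,k},\dots,\theta_{d-2,k},\phi_k)$ be random vectors that are independent of each other and of $(\tau_1,\dots,\tau_n)$, each with density $$g_{d,\nu}(\theta_1,\dots,\theta_{d-2},\phi)=\frac{\Gamma(\nu+\frac d2)}{2\pi^{\frac{d-1}2}\Gamma(\nu+\frac12)}\,\sin^{2\nu+d-2}\theta_1\,\sin^{2\nu+d-3}\theta_2\cdots\sin^{2\nu+1}\theta_{d-2}\,|\sin\phi|^{2\nu}$$ on $[0,\pi]^{d-2}\times[0,2\pi]$.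 Put $\theta_{d-1,k}=\phi_k$, and let $\mathbf X_m^d(t)=(X_1(t),\dots,X_m(t))$ with $$X_i(t)=c\sum_{k=1}^{n+1}\tau_k\,\sin\theta_{1,k}\cdots\sin\theta_{i-1,k}\cos\theta_{i,k},\qquad 1\le i\le m,$$ be the projection onto the first $m$ coordinates of the position at time $t$ of the random flight in $\mathbb R^d$ with speed $c$, step durations $\tau_k$ and directions given by the hyperspherical angles $(\theta_{1,k},\dots,\theta_{d-2,k},\phi_k)$. Put $\mu=\frac{n+1}{2}(2\nu+d-1)-\frac12$. Then for every $\alpha\in\mathbb R^m\setminus\{0\}$ $$E\,e^{i\langle\alpha,\mathbf X_m^d(t)\rangle}=\frac{2^{\mu}\,\Gamma(\mu+1)}{(ct\|\alpha\|)^{\mu}}\,J_\mu(ct\|\alpha\|),$$ where $J_\mu(x)=\sum_{k=0}^\infty\frac{(-1)^k}{k!\,\Gamma(k+\mu+1)}\left(\frac x2\right)^{2k+\mu}$ is the Bessel function; at $\alpha=0$ the characteristic function equals $1$. In particular the characteristic function depends on $\alpha$ only through $\|\alpha\|$. -/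

import Mathlib

open MeasureTheory ProbabilityTheory

noncomputable section

/-- The Bessel function of the first kind of real order `μ`, at a positive argument `x`, by its
power series. At nonpositive integers `Real.Gamma` is `0`, so that such a pole of `Γ` contributes
a zero term, as is customary. -/
def besselJ (μ x : ℝ) : ℝ :=
  ∑' k : ℕ, (-1 : ℝ) ^ k / ((Nat.factorial k : ℝ) * Real.Gamma ((k : ℝ) + μ + 1)) *
    (x / 2) ^ (2 * (k : ℝ) + μ)

/-- The region of the angles `(θ₁, …, θ_{d-2}, φ)`: the last angle `φ` ranges over `[0, 2π]`, the
others over `[0, π]`. The index `j : Fin (d - 1)` stands for the angle `θ_{j+1}`, and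
`θ_{d-1} = φ`. -/
def angleBox (d : ℕ) : Set (Fin (d - 1) → ℝ) :=
  {θ | ∀ j, 0 ≤ θ j ∧ θ j ≤ if (j : ℕ) + 1 = d - 1 then 2 * Real.pi else Real.pi}

/-- The angular density
`Γ(ν+d/2) / (2 π^{(d-1)/2} Γ(ν+1/2)) · sin^{2ν+d-2} θ₁ ⋯ sin^{2ν+1} θ_{d-2} · |sin φ|^{2ν}`.
All the sines except `sin φ` are nonnegative on the region of the angles. -/
def angleDensity (d : ℕ) (ν : ℝ) (θ : Fin (d - 1) → ℝ) : ℝ :=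
  Real.Gamma (ν + d / 2) /
      (2 * Real.pi ^ (((d : ℝ) - 1) / 2) * Real.Gamma (ν + 1 / 2)) *
    ∏ j : Fin (d - 1), |Real.sin (θ j)| ^ (2 * ν + d - 2 - ((j : ℕ) : ℝ))

/-- The law of the angles of one direction. -/
def angleLaw (d : ℕ) (ν : ℝ) : Measure (Fin (d - 1) → ℝ) :=
  (volume.restrict (angleBox d)).withDensity fun θ => ENNReal.ofReal (angleDensity d ν θ)

/-- The `n + 1` step durations `τ₁, …, τ_n, τ_{n+1} = t - (τ₁ + ⋯ + τ_n)`. -/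
def durations {n : ℕ} (t : ℝ) (τ : Fin n → ℝ) : Fin (n + 1) → ℝ :=
  Fin.snoc (α := fun _ => ℝ) τ (t - ∑ i, τ i)

/-- The region `τ₁, …, τ_n > 0`, `τ₁ + ⋯ + τ_n < t`. -/
def timeSimplex (n : ℕ) (t : ℝ) : Set (Fin n → ℝ) :=
  {τ | (∀ i, 0 < τ i) ∧ ∑ i, τ i < t}

/-- The rescaled Dirichlet density with parameters `(2ν+d-1, …, 2ν+d-1)`. -/
def timeDensity (n d : ℕ) (ν t : ℝ) (τ : Fin n → ℝ) : ℝ :=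
  Real.Gamma (((n : ℝ) + 1) * (2 * ν + d - 1)) / Real.Gamma (2 * ν + d - 1) ^ (n + 1) *
    ((∏ k : Fin (n + 1), durations t τ k ^ (2 * ν + d - 2)) /
      t ^ (((n : ℝ) + 1) * (2 * ν + d - 1) - 1))

/-- The joint law of `(τ₁, …, τ_n)`. -/
def timeLaw (n d : ℕ) (ν t : ℝ) : Measure (Fin n → ℝ) :=
  (volume.restrict (timeSimplex n t)).withDensity fun τ => ENNReal.ofReal (timeDensity n d ν t τ)

/-- The point of the unit sphere of `ℝ^d` with hyperspherical angles `θ`: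
`x₁ = cos θ₁`, `x₂ = sin θ₁ cos θ₂`, …, `x_{d-1} = sin θ₁ ⋯ sin θ_{d-2} cos φ`,
`x_d = sin θ₁ ⋯ sin θ_{d-2} sin φ`. -/
def direction (d : ℕ) (θ : Fin (d - 1) → ℝ) : EuclideanSpace ℝ (Fin d) :=
  WithLp.toLp 2 fun i =>
    (∏ j : Fin (d - 1), if (j : ℕ) < (i : ℕ) then Real.sin (θ j) else 1) *
      (if h : (i : ℕ) < d - 1 then Real.cos (θ ⟨i, h⟩) else 1)

/-- The position at time `t` of the flight with speed `c`, changes of direction separated by the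
durations `τ`, and directions with angles `θ 0, …, θ n`. -/
def flightPosition {n : ℕ} (d : ℕ) (c t : ℝ) (τ : Fin n → ℝ)
    (θ : Fin (n + 1) → Fin (d - 1) → ℝ) : EuclideanSpace ℝ (Fin d) :=
  c • ∑ k : Fin (n + 1), durations t τ k • direction d (θ k)

/-- The projection of `ℝ^d` onto the first `m` coordinates. -/
def firstCoords {m d : ℕ} (h : m ≤ d) (x : EuclideanSpace ℝ (Fin d)) :
    EuclideanSpace ℝ (Fin m) :=
  WithLp.toLp 2 fun i => x (Fin.castLE h i)

/-- `τ` and `θ` are the random durations and the random angles of the random flight in `ℝ^d`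
with parameter `ν` and `n` changes of direction in `[0, t]`. -/
structure IsRandomFlight {Ω : Type*} [MeasurableSpace Ω] (P : Measure Ω) (n d : ℕ) (ν t : ℝ)
    (τ : Ω → Fin n → ℝ) (θ : Fin (n + 1) → Ω → Fin (d - 1) → ℝ) : Prop where
  hasLaw_time : HasLaw τ (timeLaw n d ν t) P
  hasLaw_angle : ∀ k, HasLaw (θ k) (angleLaw d ν) P
  iIndepFun_angle : iIndepFun θ P
  indepFun_time_angle : IndepFun τ (fun ω k => θ k ω) P

end

/-! The proof computes moments. The linear form `⟨α, X⟩` is almost surely bounded, so its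
characteristic function is its moment series (`hasSum_integral_exp_mul_I`), and everything reduces
to showing that its `N`-th moment is `(c t ‖α‖) ^ N * besselMoment μ N`: with these moments the
series is the Bessel series (`hasSum_besselMoment`).

Since `m < d`, only the first `d - 1` coordinates of a direction occur, each a product of sines and
one cosine. A linear form `β` in them has moments `‖β‖ ^ N * besselMoment l N` with `l = ν + d/2 -
1`. This follows by induction on the number of angles: splitting off the first angle separates the
variables and leaves integrals of `sin ^ q * cos ^ k` (`exists_integral_sphereWeight_mul_pow`).

The durations are Dirichlet with all parameters equal to `2ν + d - 1 = 2l + 1`, so their mixed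
moments are quotients of Pochhammer symbols (`integral_timeLaw_prod_pow`). By independence and the
multinomial theorem, the moments of the whole flight are sums of products of `(2l+1)_j *
besselMoment l j / j!`. By Legendre duplication these numbers are the coefficients of `(1 - X²) ^
(-(l + 1/2))`. The `n + 1` steps multiply the series to `(1 - X²) ^ (-(n+1)(l + 1/2))`, which is the
same series for the order `μ`, because `μ + 1/2 = (n+1)(l + 1/2)`
(`sum_multinomial_mul_besselMoment`). -/

/-! ### Pochhammer symbols and the moments of Bessel type. -/

theorem Gamma_add_natCast {p : ℝ} (hp : 0 < p) (n : ℕ) :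
    Real.Gamma (p + n) = (ascPochhammer ℝ n).eval p * Real.Gamma p := by
  induction n with
  | zero => simp
  | succ n ih =>
    rw [ascPochhammer_succ_eval, Nat.cast_succ, ← add_assoc, Real.Gamma_add_one (by positivity), ih]
    ring

/-- Legendre duplication: the factors `2p + 2k` and `2p + 2k + 1` are `2(p + k)` and `2(p + 1/2 +
k)`. -/
theorem ascPochhammer_eval_two_mul (p : ℝ) (n : ℕ) :
    (ascPochhammer ℝ (2 * n)).eval (2 * p) =
      4 ^ n * (ascPochhammer ℝ n).eval p * (ascPochhammer ℝ n).eval (p + 1 / 2) := by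
  induction n with
  | zero => simp
  | succ n ih =>
    rw [show 2 * (n + 1) = 2 * n + 1 + 1 by ring]
    simp only [ascPochhammer_succ_eval, ih]
    push_cast
    ring

/-- The moments of a coordinate of a uniform point of the unit sphere of dimension `2 * l + 1`.
Their exponential generating function at `I * x` is the normalised Bessel function
`2 ^ l * Γ (l + 1) * x ^ (-l) * J_l x`. -/
noncomputable def besselMoment (l : ℝ) (N : ℕ) : ℝ :=
  if Even N then
    (N.factorial : ℝ) / (2 ^ N * (N / 2).factorial * (ascPochhammer ℝ (N / 2)).eval (l + 1))
  else 0

theorem besselMoment_two_mul (l : ℝ) (n : ℕ) :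
    besselMoment l (2 * n) =
      ((2 * n).factorial : ℝ) / (4 ^ n * n.factorial * (ascPochhammer ℝ n).eval (l + 1)) := by
  rw [besselMoment, if_pos (even_two_mul n), Nat.mul_div_cancel_left n two_pos, pow_mul]
  norm_num

theorem besselMoment_of_odd (l : ℝ) {N : ℕ} (h : Odd N) : besselMoment l N = 0 :=
  if_neg (Nat.not_even_iff_odd.2 h)

theorem besselMoment_zero (l : ℝ) : besselMoment l 0 = 1 := by
  simp [besselMoment]

theorem Finset.sum_range_two_mul_add_one {M : Type*} [AddCommMonoid M] (f : ℕ → M)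
    (hf : ∀ k, Odd k → f k = 0) (n : ℕ) :
    ∑ k ∈ Finset.range (2 * n + 1), f k = ∑ k ∈ Finset.range (n + 1), f (2 * k) := by
  induction n with
  | zero => simp
  | succ n ih =>
    rw [show 2 * (n + 1) + 1 = 2 * n + 1 + 1 + 1 by ring, Finset.sum_range_succ,
      Finset.sum_range_succ, ih, hf _ (odd_two_mul_add_one n), add_zero,
      Finset.sum_range_succ _ (n + 1)]
    rfl

/-- The moments of `x cos θ + √s sin θ Y`, in terms of those of `Y`. -/
theorem sum_choose_mul_besselMoment {l : ℝ} (hl : 0 ≤ l) (x s : ℝ) (n : ℕ) :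
    ∑ k ∈ Finset.range (n + 1), ((2 * n).choose (2 * k) : ℝ) * x ^ (2 * k) * s ^ (n - k) *
        besselMoment (l - 1 / 2) (2 * (n - k)) *
        ((ascPochhammer ℝ (n - k)).eval (l + 1 / 2) *
          (((2 * k).factorial : ℝ) / (4 ^ k * k.factorial)) / (ascPochhammer ℝ n).eval (l + 1)) =
      (x ^ 2 + s) ^ n * besselMoment l (2 * n) := by
  -- After binomial expansion of the right side the two sums agree term by term: `(l + 1/2)_(n-k)`
  -- cancels the denominator of the moment of order `l - 1/2`.
  rw [add_pow, Finset.sum_mul]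
  refine Finset.sum_congr rfl fun k hk => ?_
  obtain ⟨u, rfl⟩ := Nat.exists_eq_add_of_le (Nat.lt_succ_iff.1 (Finset.mem_range.1 hk))
  rw [Nat.add_sub_cancel_left, besselMoment_two_mul, besselMoment_two_mul, mul_add,
    show l - 1 / 2 + 1 = l + 1 / 2 by ring, Nat.cast_add_choose,
    Nat.cast_add_choose]
  have h1 : 0 < (ascPochhammer ℝ u).eval (l + 1 / 2) := ascPochhammer_pos _ _ (by positivity)
  have h2 : 0 < (ascPochhammer ℝ (k + u)).eval (l + 1) := ascPochhammer_pos _ _ (by positivity)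
  generalize (ascPochhammer ℝ u).eval (l + 1 / 2) = A at h1 ⊢
  field_simp
  ring

/-! ### The generating function and Dirichlet mixtures. -/

/-- The power series of `(1 - X ^ 2) ^ (-p)`. -/
noncomputable def invOneSubSqPow (p : ℝ) : PowerSeries ℝ :=
  PowerSeries.expand 2 two_ne_zero
    (PowerSeries.rescale (-1) (PowerSeries.binomialSeries ℝ (-p)))

theorem invOneSubSqPow_pow (p : ℝ) (n : ℕ) : invOneSubSqPow p ^ n = invOneSubSqPow (n * p) := by
  induction n with
  | zero => simp [invOneSubSqPow]
  | succ n ih =>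
    rw [pow_succ, ih, invOneSubSqPow, invOneSubSqPow, ← map_mul, ← map_mul,
      ← PowerSeries.binomialSeries_add, invOneSubSqPow]
    congr 4
    push_cast
    ring

/-- The sign in `choose (-p) n = (-1) ^ n * multichoose p n` cancels the one from rescaling by `-1`.
-/
theorem coeff_invOneSubSqPow_two_mul (p : ℝ) (n : ℕ) :
    PowerSeries.coeff (2 * n) (invOneSubSqPow p) = (ascPochhammer ℝ n).eval p / n.factorial := by
  have h := Ring.factorial_nsmul_multichoose_eq_ascPochhammer p n
  rw [Polynomial.ascPochhammer_smeval_eq_eval, nsmul_eq_mul] at h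
  rw [invOneSubSqPow, PowerSeries.coeff_expand_mul, PowerSeries.coeff_rescale,
    PowerSeries.binomialSeries_coeff, Ring.choose_neg', ← h, Units.smul_def, zsmul_eq_mul,
    Int.cast_negOnePow_natCast, smul_eq_mul, mul_one, ← mul_assoc, ← mul_pow,
    mul_div_cancel_left₀ _ (by positivity)]
  simp

theorem coeff_invOneSubSqPow_odd (p : ℝ) {N : ℕ} (hN : Odd N) :
    PowerSeries.coeff N (invOneSubSqPow p) = 0 := by
  rw [invOneSubSqPow, PowerSeries.coeff_expand_of_not_dvd]
  exact fun h => Nat.not_even_iff_odd.2 hN (even_iff_two_dvd.2 h)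

/-- Legendre duplication turns the moments of order `l` into binomial coefficients. -/
theorem ascPochhammer_mul_besselMoment {l : ℝ} (hl : 0 ≤ l) (N : ℕ) :
    (ascPochhammer ℝ N).eval (2 * l + 1) * besselMoment l N / N.factorial =
      PowerSeries.coeff N (invOneSubSqPow (l + 1 / 2)) := by
  rcases Nat.even_or_odd' N with ⟨n, rfl | rfl⟩
  · rw [besselMoment_two_mul, coeff_invOneSubSqPow_two_mul, show 2 * l + 1 = 2 * (l + 1 / 2) by ring,
      ascPochhammer_eval_two_mul, show l + 1 / 2 + 1 / 2 = l + 1 by ring]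
    have h2 : 0 < (ascPochhammer ℝ n).eval (l + 1) := ascPochhammer_pos _ _ (by positivity)
    field_simp
  · rw [besselMoment_of_odd _ (odd_two_mul_add_one n),
      coeff_invOneSubSqPow_odd _ (odd_two_mul_add_one n)]
    simp

theorem PowerSeries.coeff_pow_eq_sum_piAntidiag {R : Type*} [CommSemiring R] (f : PowerSeries R)
    (n N : ℕ) :
    PowerSeries.coeff N (f ^ n) =
      ∑ j ∈ Finset.piAntidiag (Finset.univ : Finset (Fin n)) N,
        ∏ k, PowerSeries.coeff (j k) f := by
  rw [← Fin.prod_const, PowerSeries.coeff_prod]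
  refine Finset.sum_equiv Finsupp.equivFunOnFinite (fun j => ?_) fun j _ => rfl
  simp [Finset.mem_finsuppAntidiag]

theorem Nat.cast_multinomial_univ {ι : Type*} [Fintype ι] (j : ι → ℕ) :
    (Nat.multinomial Finset.univ j : ℝ) = (∑ k, j k).factorial / ∏ k, ((j k).factorial : ℝ) := by
  rw [eq_div_iff (Finset.prod_ne_zero_iff.2 fun k _ => by positivity), mul_comm]
  exact_mod_cast Nat.multinomial_spec Finset.univ j

/-- The moments of a Dirichlet mixture of independent variables with moments `besselMoment l`. -/
theorem sum_multinomial_mul_besselMoment {l μ : ℝ} (hl : 0 ≤ l) (n : ℕ)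
    (hμ : μ = (n + 1) * (l + 1 / 2) - 1 / 2) (N : ℕ) :
    ∑ j ∈ Finset.piAntidiag (Finset.univ : Finset (Fin (n + 1))) N,
        (Nat.multinomial Finset.univ j : ℝ) *
          ((∏ k, (ascPochhammer ℝ (j k)).eval (2 * l + 1)) /
            (ascPochhammer ℝ N).eval ((n + 1) * (2 * l + 1)) * ∏ k, besselMoment l (j k)) =
      besselMoment μ N := by
  have hμ0 : 0 ≤ μ := by rw [hμ]; nlinarith [Nat.cast_nonneg (α := ℝ) n]
  have hA : 0 < (ascPochhammer ℝ N).eval ((n + 1) * (2 * l + 1)) :=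
    ascPochhammer_pos _ _ (by positivity)
  have h := ascPochhammer_mul_besselMoment hμ0 N
  -- The choice of `μ` makes the series of order `μ` the `(n + 1)`-st power of the series of order
  -- `l`, whose coefficients are convolutions.
  rw [show 2 * μ + 1 = (n + 1) * (2 * l + 1) by rw [hμ]; ring,
    show μ + 1 / 2 = ((n + 1 : ℕ) : ℝ) * (l + 1 / 2) by rw [hμ]; push_cast; ring,
    ← invOneSubSqPow_pow, PowerSeries.coeff_pow_eq_sum_piAntidiag, div_eq_iff (by positivity),
    mul_comm, ← eq_div_iff hA.ne'] at h
  rw [h, Finset.sum_mul, Finset.sum_div]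
  refine Finset.sum_congr rfl fun j hj => ?_
  have hj : ∑ k, j k = N := (Finset.mem_piAntidiag.1 hj).1
  simp_rw [← ascPochhammer_mul_besselMoment hl]
  rw [Nat.cast_multinomial_univ, hj, Finset.prod_div_distrib, Finset.prod_mul_distrib]
  ring

/-! ### Integrals of powers of sine and cosine. -/

noncomputable section
/-- The integral of `sin ^ q * cos ^ k` over `[0, π]`. -/
def sinCosIntegral (q : ℝ) (k : ℕ) : ℝ :=
  ∫ x in (0 : ℝ)..Real.pi, |Real.sin x| ^ q * Real.cos x ^ k

end

theorem continuous_abs_sin_rpow {q : ℝ} (hq : 0 ≤ q) : Continuous fun x => |Real.sin x| ^ q :=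
  (Real.continuous_sin.abs).rpow_const fun _ => Or.inr hq

theorem intervalIntegrable_sin_rpow_mul_cos_pow {q : ℝ} (hq : 0 ≤ q) (k : ℕ) (a b : ℝ) :
    IntervalIntegrable (fun x => |Real.sin x| ^ q * Real.cos x ^ k) volume a b :=
  ((continuous_abs_sin_rpow hq).mul (Real.continuous_cos.pow k)).intervalIntegrable a b

theorem sinCosIntegral_add_two_add {q : ℝ} (hq : 0 ≤ q) (k : ℕ) :
    sinCosIntegral (q + 2) k + sinCosIntegral q (k + 2) = sinCosIntegral q k := by
  rw [sinCosIntegral, sinCosIntegral, sinCosIntegral, ← intervalIntegral.integral_add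
    (intervalIntegrable_sin_rpow_mul_cos_pow (by positivity) _ _ _)
    (intervalIntegrable_sin_rpow_mul_cos_pow hq _ _ _)]
  refine intervalIntegral.integral_congr fun x _ => ?_
  have h : |Real.sin x| ^ (q + 2) = |Real.sin x| ^ q * Real.sin x ^ 2 := by
    rw [← sq_abs (Real.sin x)]
    exact_mod_cast Real.rpow_add_natCast' (abs_nonneg _) (n := 2) (by positivity)
  simp only [h, Real.sin_sq]
  ring

/-- The integrand is the derivative of `|sin| ^ (q + 1) * cos ^ k`, which vanishes at both ends. For
`k = 0` the truncated exponent `k - 1` is harmless, as its term has the factor `k`. -/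
theorem integral_deriv_sin_rpow_mul_cos_pow {q : ℝ} (hq : 0 ≤ q) (k : ℕ) :
    ∫ x in (0 : ℝ)..Real.pi, ((q + 1) * (|Real.sin x| ^ q * Real.cos x ^ (k + 1)) -
      k * (|Real.sin x| ^ (q + 2) * Real.cos x ^ (k - 1))) = 0 := by
  have h := intervalIntegral.integral_eq_sub_of_hasDerivAt_of_le Real.pi_pos.le
    (f := fun x => |Real.sin x| ^ (q + 1) * Real.cos x ^ k)
    (f' := fun x => (q + 1) * (|Real.sin x| ^ q * Real.cos x ^ (k + 1)) -
      k * (|Real.sin x| ^ (q + 2) * Real.cos x ^ (k - 1)))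
    ((continuous_abs_sin_rpow (by positivity)).mul (Real.continuous_cos.pow k)).continuousOn
    (fun x hx => ?_)
    (((intervalIntegrable_sin_rpow_mul_cos_pow hq _ _ _).const_mul _).sub
      ((intervalIntegrable_sin_rpow_mul_cos_pow (by positivity) _ _ _).const_mul _))
  · rw [h]
    simp [Real.zero_rpow (by positivity : q + 1 ≠ 0)]
  · have hs : 0 < Real.sin x := Real.sin_pos_of_mem_Ioo hx
    have h1 : HasDerivAt (fun x => Real.sin x ^ (q + 1) * Real.cos x ^ k)
        (Real.cos x * (q + 1) * Real.sin x ^ (q + 1 - 1) * Real.cos x ^ k +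
          Real.sin x ^ (q + 1) * (k * Real.cos x ^ (k - 1) * -Real.sin x)) x :=
      ((Real.hasDerivAt_sin x).rpow_const (Or.inl hs.ne')).mul ((Real.hasDerivAt_cos x).pow k)
    refine (h1.congr_of_eventuallyEq ?_).congr_deriv ?_
    · filter_upwards [Ioo_mem_nhds hx.1 hx.2] with y hy
      rw [abs_of_pos (Real.sin_pos_of_mem_Ioo hy)]
    · rw [abs_of_pos hs, add_sub_cancel_right, show q + 2 = q + 1 + 1 by ring,
        Real.rpow_add_one hs.ne' (q + 1)]
      ring

theorem sinCosIntegral_one {q : ℝ} (hq : 0 ≤ q) : sinCosIntegral q 1 = 0 := by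
  have h := integral_deriv_sin_rpow_mul_cos_pow hq 0
  simp only [Nat.cast_zero, zero_mul, sub_zero, zero_add,
    intervalIntegral.integral_const_mul] at h
  exact (mul_eq_zero.1 h).resolve_left (by positivity)

/-- Integration by parts trades `cos ^ 2` for `sin ^ 2`; together with `sin² + cos² = 1` this is a
linear system for both integrals. -/
theorem sinCosIntegral_cos_add_two {q : ℝ} (hq : 0 ≤ q) (k : ℕ) :
    sinCosIntegral q (k + 2) = (k + 1) / (q + k + 2) * sinCosIntegral q k := by
  have h := integral_deriv_sin_rpow_mul_cos_pow hq (k + 1)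
  rw [intervalIntegral.integral_sub
      ((intervalIntegrable_sin_rpow_mul_cos_pow hq _ _ _).const_mul _)
      ((intervalIntegrable_sin_rpow_mul_cos_pow (by positivity) _ _ _).const_mul _),
    intervalIntegral.integral_const_mul, intervalIntegral.integral_const_mul] at h
  change (q + 1) * sinCosIntegral q (k + 2) - (k + 1 : ℕ) * sinCosIntegral (q + 2) k = 0 at h
  push_cast at h
  have h2 := sinCosIntegral_add_two_add hq k
  rw [div_mul_eq_mul_div, eq_div_iff (by positivity)]
  linear_combination h + (k + 1) * h2

theorem sinCosIntegral_sin_add_two {q : ℝ} (hq : 0 ≤ q) (k : ℕ) :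
    sinCosIntegral (q + 2) k = (q + 1) / (q + k + 2) * sinCosIntegral q k := by
  have h2 := sinCosIntegral_add_two_add hq k
  rw [sinCosIntegral_cos_add_two hq] at h2
  rw [eq_sub_of_add_eq h2]
  field_simp
  ring

theorem sinCosIntegral_of_odd {q : ℝ} (hq : 0 ≤ q) {k : ℕ} (hk : Odd k) :
    sinCosIntegral q k = 0 := by
  obtain ⟨n, rfl⟩ := hk
  induction n with
  | zero => exact sinCosIntegral_one hq
  | succ n ih =>
    rw [show 2 * (n + 1) + 1 = 2 * n + 1 + 2 by ring, sinCosIntegral_cos_add_two hq, ih, mul_zero]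

/-- The two recursions reduce everything to `sinCosIntegral (2 * l) 0`. That base value is left
unevaluated: it is absorbed into a normalising constant. -/
theorem sinCosIntegral_even {l : ℝ} (hl : 0 ≤ l) (u v : ℕ) :
    sinCosIntegral (2 * l + 2 * v) (2 * u) = sinCosIntegral (2 * l) 0 *
      ((ascPochhammer ℝ v).eval (l + 1 / 2) * (((2 * u).factorial : ℝ) / (4 ^ u * u.factorial)) /
        (ascPochhammer ℝ (u + v)).eval (l + 1)) := by
  induction u with
  | zero =>
    induction v with
    | zero => simp
    | succ v ih =>
      have h1 : 0 < (ascPochhammer ℝ v).eval (l + 1) := ascPochhammer_pos _ _ (by positivity)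
      rw [show 2 * l + 2 * ((v + 1 : ℕ) : ℝ) = 2 * l + 2 * v + 2 by push_cast; ring,
        sinCosIntegral_sin_add_two (by positivity), ih]
      simp only [zero_add, ascPochhammer_succ_eval]
      push_cast
      field_simp
      ring
  | succ u ih =>
    have h1 : 0 < (ascPochhammer ℝ (u + v)).eval (l + 1) := ascPochhammer_pos _ _ (by positivity)
    rw [show 2 * (u + 1) = 2 * u + 2 by ring, sinCosIntegral_cos_add_two (by positivity), ih,
      show u + 1 + v = u + v + 1 by ring, ascPochhammer_succ_eval, Nat.factorial_succ,
      Nat.factorial_succ, Nat.factorial_succ]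
    push_cast
    field_simp
    ring

/-! ### Moments of linear forms in the coordinates of a direction. -/

noncomputable section

/-- The unnormalised density of an angle which is followed by `r - 1` further angles. -/
def angleWeight (ν : ℝ) (r : ℕ) : ℝ → ℝ :=
  (Set.Icc 0 (if r = 1 then 2 * Real.pi else Real.pi)).indicator
    fun x => |Real.sin x| ^ (2 * ν + r - 1)

/-- The unnormalised joint density of `e` hyperspherical angles. -/
def sphereWeight (ν : ℝ) (e : ℕ) (θ : Fin e → ℝ) : ℝ :=
  ∏ j : Fin e, angleWeight ν (e - j) (θ j)

/-- The first `e` coordinates of the point with `e` hyperspherical angles `θ`. -/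
def sphereCoord (e : ℕ) (θ : Fin e → ℝ) (i : Fin e) : ℝ :=
  (∏ j : Fin e, if (j : ℕ) < (i : ℕ) then Real.sin (θ j) else 1) * Real.cos (θ i)

end

theorem angleExponent_nonneg {ν : ℝ} (hν : 0 ≤ ν) {r : ℕ} (hr : 1 ≤ r) : 0 ≤ 2 * ν + r - 1 := by
  have : (1 : ℝ) ≤ r := by exact_mod_cast hr
  linarith

theorem integrable_angleWeight_mul {ν : ℝ} (hν : 0 ≤ ν) {r : ℕ} (hr : 1 ≤ r) {g : ℝ → ℝ}
    (hg : Continuous g) : Integrable fun x => angleWeight ν r x * g x := by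
  have h : (fun x => angleWeight ν r x * g x) =
      (Set.Icc 0 (if r = 1 then 2 * Real.pi else Real.pi)).indicator
        fun x => |Real.sin x| ^ (2 * ν + r - 1) * g x := by
    ext x
    rw [angleWeight, Set.indicator_mul_left]
  rw [h, integrable_indicator_iff measurableSet_Icc]
  exact ((continuous_abs_sin_rpow (angleExponent_nonneg hν hr)).mul hg).integrableOn_Icc

/-- An even power of the sine merges with the power of `|sin|`. For the last angle, the half `[π,
2π]` contributes `(-1) ^ k` times the half `[0, π]`; as both vanish for odd `k`, the total is always
twice the first half. -/
theorem integral_angleWeight_mul {ν : ℝ} (hν : 0 ≤ ν) {r : ℕ} (hr : 1 ≤ r) (k : ℕ) {l : ℕ}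
    (hl : Even l) :
    ∫ x, angleWeight ν r x * (Real.cos x ^ k * Real.sin x ^ l) =
      (if r = 1 then 2 else 1) * sinCosIntegral (2 * ν + r - 1 + l) k := by
  have hq := angleExponent_nonneg hν hr
  have hq' : 0 ≤ 2 * ν + r - 1 + l := by positivity
  set g : ℝ → ℝ := fun x => |Real.sin x| ^ (2 * ν + r - 1 + l) * Real.cos x ^ k with hg
  have h : (fun x => angleWeight ν r x * (Real.cos x ^ k * Real.sin x ^ l)) =
      (Set.Icc 0 (if r = 1 then 2 * Real.pi else Real.pi)).indicator g := by
    ext x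
    rw [angleWeight, Set.indicator_apply, Set.indicator_apply, ite_mul, zero_mul]
    congr 1
    simp only [hg]
    rw [Real.rpow_add_of_nonneg (abs_nonneg _) hq (by positivity), Real.rpow_natCast, hl.pow_abs]
    ring
  have hi : ∀ a b, IntervalIntegrable g volume a b :=
    intervalIntegrable_sin_rpow_mul_cos_pow hq' k
  have hpos : (0 : ℝ) ≤ if r = 1 then 2 * Real.pi else Real.pi := by
    split_ifs <;> positivity
  rw [h, integral_indicator measurableSet_Icc, integral_Icc_eq_integral_Ioc,
    ← intervalIntegral.integral_of_le hpos]
  split_ifs with h1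
  · rw [← intervalIntegral.integral_add_adjacent_intervals (hi 0 Real.pi) (hi _ _)]
    have h2 : ∫ x in Real.pi..2 * Real.pi, g x =
        (-1) ^ k * sinCosIntegral (2 * ν + r - 1 + l) k := by
      have h3 := intervalIntegral.integral_comp_add_right (a := 0) (b := Real.pi) g Real.pi
      rw [zero_add, ← two_mul] at h3
      rw [← h3, sinCosIntegral, ← intervalIntegral.integral_const_mul]
      refine intervalIntegral.integral_congr fun x _ => ?_
      simp only [hg, Real.sin_add_pi, Real.cos_add_pi, abs_neg]
      rw [neg_pow]
      ring
    rw [h2]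
    change sinCosIntegral (2 * ν + r - 1 + l) k + _ = _
    rcases Nat.even_or_odd k with hk | hk
    · rw [hk.neg_one_pow]; ring
    · rw [sinCosIntegral_of_odd hq' hk]; ring
  · rw [one_mul, sinCosIntegral]

theorem sphereWeight_cons (ν : ℝ) (e : ℕ) (x : ℝ) (θ : Fin e → ℝ) :
    sphereWeight ν (e + 1) (Fin.cons x θ) = angleWeight ν (e + 1) x * sphereWeight ν e θ := by
  simp [sphereWeight, Fin.prod_univ_succ]

theorem sphereCoord_cons_zero (e : ℕ) (x : ℝ) (θ : Fin e → ℝ) :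
    sphereCoord (e + 1) (Fin.cons x θ) 0 = Real.cos x := by
  simp [sphereCoord]

theorem sphereCoord_cons_succ (e : ℕ) (x : ℝ) (θ : Fin e → ℝ) (i : Fin e) :
    sphereCoord (e + 1) (Fin.cons x θ) i.succ = Real.sin x * sphereCoord e θ i := by
  simp [sphereCoord, Fin.prod_univ_succ, mul_assoc]

/-- The form is `α 0 * cos x + sin x * (form in the remaining angles)`, so its binomial expansion
separates the first angle from the others. -/
theorem sphereWeight_mul_pow_cons (ν : ℝ) (e N : ℕ) (α : Fin (e + 1) → ℝ) (x : ℝ)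
    (θ : Fin e → ℝ) :
    sphereWeight ν (e + 1) (Fin.cons x θ) *
        (∑ i, α i * sphereCoord (e + 1) (Fin.cons x θ) i) ^ N =
      ∑ k ∈ Finset.range (N + 1), ((N.choose k : ℝ) * α 0 ^ k) *
        ((angleWeight ν (e + 1) x * (Real.cos x ^ k * Real.sin x ^ (N - k))) *
          (sphereWeight ν e θ * (∑ i : Fin e, α i.succ * sphereCoord e θ i) ^ (N - k))) := by
  have h : ∑ i, α i * sphereCoord (e + 1) (Fin.cons x θ) i =
      α 0 * Real.cos x + Real.sin x * ∑ i : Fin e, α i.succ * sphereCoord e θ i := by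
    rw [Fin.sum_univ_succ, sphereCoord_cons_zero, Finset.mul_sum]
    simp only [sphereCoord_cons_succ]
    congr 1
    exact Finset.sum_congr rfl fun i _ => by ring
  rw [h, add_pow, sphereWeight_cons, Finset.mul_sum]
  refine Finset.sum_congr rfl fun k _ => ?_
  rw [mul_pow, mul_pow]
  ring

/-- The inductive step in the number of angles. If `N - k` is odd the moment of the remaining angles
vanishes; if `N - k` is even and `k` odd the cosine integral does. So only even `N` and `k` matter,
and the truncated halves are exact there. -/
theorem sum_choose_mul_moment {ν : ℝ} (hν : 0 ≤ ν) (e N : ℕ) (x s : ℝ) :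
    ∑ k ∈ Finset.range (N + 1), ((N.choose k : ℝ) * x ^ k) *
        ((∫ y, angleWeight ν (e + 1) y * (Real.cos y ^ k * Real.sin y ^ (N - k))) *
          (s ^ ((N - k) / 2) * besselMoment (ν + ((e : ℝ) - 1) / 2) (N - k))) =
      ((if e + 1 = 1 then 2 else 1) * sinCosIntegral (2 * (ν + (e : ℝ) / 2)) 0) *
        ((x ^ 2 + s) ^ (N / 2) * besselMoment (ν + (e : ℝ) / 2) N) := by
  have hl : 0 ≤ ν + (e : ℝ) / 2 := by positivity
  have hq : 2 * ν + ((e + 1 : ℕ) : ℝ) - 1 = 2 * (ν + (e : ℝ) / 2) := by push_cast; ring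
  have key : ∀ k, Even (N - k) →
      ∫ y, angleWeight ν (e + 1) y * (Real.cos y ^ k * Real.sin y ^ (N - k)) =
        (if e + 1 = 1 then 2 else 1) *
          sinCosIntegral (2 * (ν + (e : ℝ) / 2) + (N - k : ℕ)) k := fun k hk => by
    rw [integral_angleWeight_mul hν (by omega) k hk, hq]
  have hodd : ∀ k ≤ N, Odd N ∨ Odd k → ((N.choose k : ℝ) * x ^ k) *
        ((∫ y, angleWeight ν (e + 1) y * (Real.cos y ^ k * Real.sin y ^ (N - k))) *
          (s ^ ((N - k) / 2) * besselMoment (ν + ((e : ℝ) - 1) / 2) (N - k))) = 0 := by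
    intro k hkN hk
    rcases Nat.even_or_odd (N - k) with h | h
    · have hk' : Odd k := by
        rcases hk with hk | hk
        · rw [← Nat.sub_add_cancel hkN] at hk
          exact (Nat.odd_add'.1 hk).2 h
        · exact hk
      rw [key k h, sinCosIntegral_of_odd (by positivity) hk']
      simp
    · rw [besselMoment_of_odd _ h]
      simp
  rcases Nat.even_or_odd' N with ⟨n, rfl | rfl⟩
  -- The summand is cut off beyond `2 * n` so that it vanishes at every odd `k`, not only at those
  -- in the range.
  · have h2 := Finset.sum_range_two_mul_add_one (fun k => if k ≤ 2 * n then
        (((2 * n).choose k : ℝ) * x ^ k) *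
        ((∫ y, angleWeight ν (e + 1) y * (Real.cos y ^ k * Real.sin y ^ (2 * n - k))) *
          (s ^ ((2 * n - k) / 2) * besselMoment (ν + ((e : ℝ) - 1) / 2) (2 * n - k))) else 0)
      (fun k hk => by
        split_ifs with h
        · exact hodd k h (Or.inr hk)
        · rfl) n
    rw [Finset.sum_congr rfl fun k hk =>
      if_pos (Nat.lt_succ_iff.1 (Finset.mem_range.1 hk))] at h2
    rw [h2, Nat.mul_div_cancel_left n two_pos, ← sum_choose_mul_besselMoment hl x s n,
      Finset.mul_sum]
    refine Finset.sum_congr rfl fun k hk => ?_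
    have hk : k ≤ n := Nat.lt_succ_iff.1 (Finset.mem_range.1 hk)
    rw [if_pos (by omega), key _ (by rw [← Nat.mul_sub]; exact even_two_mul _), ← Nat.mul_sub,
      Nat.mul_div_cancel_left _ two_pos, Nat.cast_mul, Nat.cast_two, sinCosIntegral_even hl,
      Nat.add_sub_cancel' hk, show ν + ((e : ℝ) - 1) / 2 = ν + (e : ℝ) / 2 - 1 / 2 by ring]
    ring
  · rw [besselMoment_of_odd _ (odd_two_mul_add_one n), Finset.sum_eq_zero]
    · simp
    · exact fun k hk => hodd k (Nat.lt_succ_iff.1 (Finset.mem_range.1 hk))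
        (Or.inl (odd_two_mul_add_one n))

/-- What matters is that `C` depends neither on `N` nor on `α`: the case `N = 0` later determines
it. Each angle raises the order by `1/2`. -/
theorem exists_integral_sphereWeight_mul_pow {ν : ℝ} (hν : 0 ≤ ν) (e : ℕ) :
    ∃ C : ℝ, ∀ (N : ℕ) (α : Fin e → ℝ),
      Integrable (fun θ => sphereWeight ν e θ * (∑ i, α i * sphereCoord e θ i) ^ N) ∧
      ∫ θ, sphereWeight ν e θ * (∑ i, α i * sphereCoord e θ i) ^ N =
        C * ((∑ i, α i ^ 2) ^ (N / 2) * besselMoment (ν + ((e : ℝ) - 1) / 2) N) := by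
  induction e with
  | zero =>
    -- Without angles the linear form is zero and the space is one point, so only `N = 0`
    -- contributes.
    refine ⟨1, fun N α => ⟨?_, ?_⟩⟩
    · rw [volume_pi, Measure.pi_of_empty]
      exact integrable_dirac enorm_lt_top
    · rw [volume_pi, Measure.pi_of_empty, integral_dirac]
      rcases Nat.even_or_odd' N with ⟨n, rfl | rfl⟩
      · rcases n with _ | n
        · simp [sphereWeight, besselMoment_zero]
        · simp
      · rw [besselMoment_of_odd _ (odd_two_mul_add_one n)]
        simp
  | succ e ih =>
    obtain ⟨C, hC⟩ := ih
    refine ⟨(if e + 1 = 1 then 2 else 1) * sinCosIntegral (2 * (ν + (e : ℝ) / 2)) 0 * C,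
      fun N α => ?_⟩
    have mp := (volume_preserving_piFinSuccAbove (fun _ : Fin (e + 1) => ℝ) 0).symm
    have hcons : ∀ p : ℝ × (Fin e → ℝ),
        (MeasurableEquiv.piFinSuccAbove (fun _ : Fin (e + 1) => ℝ) 0).symm p =
          Fin.cons p.1 p.2 := fun p => by
      simp [MeasurableEquiv.piFinSuccAbove, Fin.insertNthEquiv]
    have hint : ∀ k ∈ Finset.range (N + 1), Integrable (fun p : ℝ × (Fin e → ℝ) =>
        ((N.choose k : ℝ) * α 0 ^ k) *
        ((angleWeight ν (e + 1) p.1 * (Real.cos p.1 ^ k * Real.sin p.1 ^ (N - k))) *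
          (sphereWeight ν e p.2 * (∑ i : Fin e, α i.succ * sphereCoord e p.2 i) ^ (N - k))))
        (volume.prod volume) := fun k _ =>
      ((integrable_angleWeight_mul hν (by omega)
        ((Real.continuous_cos.pow k).mul (Real.continuous_sin.pow (N - k)))).mul_prod
        (hC (N - k) fun i => α i.succ).1).const_mul _
    constructor
    · rw [← mp.integrable_comp_emb (MeasurableEquiv.measurableEmbedding _)]
      simp only [Function.comp_def, hcons, sphereWeight_mul_pow_cons]
      exact integrable_finsetSum _ hint
    · rw [← mp.integral_comp']
      simp only [hcons, sphereWeight_mul_pow_cons]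
      rw [Measure.volume_eq_prod, integral_finsetSum _ hint]
      have h := sum_choose_mul_moment hν e N (α 0) (∑ i : Fin e, α i.succ ^ 2)
      rw [Fin.sum_univ_succ, show ((e + 1 : ℕ) : ℝ) - 1 = e by push_cast; ring, mul_right_comm,
        ← h, Finset.sum_mul]
      refine Finset.sum_congr rfl fun k _ => ?_
      rw [integral_const_mul, integral_prod_mul
        (fun x => angleWeight ν (e + 1) x * (Real.cos x ^ k * Real.sin x ^ (N - k)))
        (fun θ => sphereWeight ν e θ * (∑ i : Fin e, α i.succ * sphereCoord e θ i) ^ (N - k)),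
        (hC _ _).2]
      ring

/-! ### Dirichlet integrals and the moments of the durations. -/

/-- The substitution `x = s * y` turns this into the total mass of the beta density. -/
theorem lintegral_rpow_mul_sub_rpow {a b s : ℝ} (ha : 0 < a) (hb : 0 < b) (hs : 0 < s) :
    ∫⁻ x in Set.Ioo 0 s, ENNReal.ofReal (x ^ (a - 1)) * ENNReal.ofReal ((s - x) ^ (b - 1)) =
      ENNReal.ofReal (s ^ (a + b - 1) * beta a b) := by
  have hβ := beta_pos ha hb
  have himg : (fun x => s * x) '' Set.Ioo (0 : ℝ) 1 = Set.Ioo 0 s := by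
    rw [Set.image_mul_left_Ioo hs, mul_zero, mul_one]
  have h1 := lintegral_betaPDF_eq_one ha hb
  rw [lintegral_betaPDF] at h1
  rw [← himg, lintegral_image_eq_lintegral_abs_deriv_mul (s := Set.Ioo (0 : ℝ) 1)
    measurableSet_Ioo
    (f' := fun _ => s) (fun x _ => by simpa using ((hasDerivAt_id x).const_mul s).hasDerivWithinAt)
    (mul_right_injective₀ hs.ne').injOn, ← mul_one (ENNReal.ofReal (_ * beta a b)), ← h1,
    ← lintegral_const_mul' _ _ ENNReal.ofReal_ne_top]
  refine setLIntegral_congr_fun measurableSet_Ioo fun x hx => ?_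
  have hx1 : 0 < 1 - x := sub_pos.2 hx.2
  have hx0 := hx.1
  rw [← ENNReal.ofReal_mul (by positivity), ← ENNReal.ofReal_mul (by positivity),
    ← ENNReal.ofReal_mul (by positivity), abs_of_pos hs, show s - s * x = s * (1 - x) by ring,
    Real.mul_rpow hs.le hx0.le, Real.mul_rpow hs.le hx1.le,
    show a + b - 1 = 1 + (a - 1) + (b - 1) by ring, Real.rpow_add hs, Real.rpow_add hs,
    Real.rpow_one]
  congr 1
  field_simp

theorem durations_cons {n : ℕ} (s x : ℝ) (τ : Fin n → ℝ) :
    durations s (Fin.cons x τ : Fin (n + 1) → ℝ) = Fin.cons x (durations (s - x) τ) := by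
  rw [durations, durations, Fin.cons_snoc_eq_snoc_cons, Fin.sum_univ_succ]
  simp [sub_sub]

theorem cons_mem_timeSimplex {n : ℕ} {s x : ℝ} {τ : Fin n → ℝ} :
    (Fin.cons x τ : Fin (n + 1) → ℝ) ∈ timeSimplex (n + 1) s ↔
      0 < x ∧ τ ∈ timeSimplex n (s - x) := by
  simp [timeSimplex, Fin.forall_fin_succ, Fin.sum_univ_succ, lt_sub_iff_add_lt', and_assoc]

theorem durations_pos {n : ℕ} {s : ℝ} {τ : Fin n → ℝ} (h : τ ∈ timeSimplex n s)
    (k : Fin (n + 1)) : 0 < durations s τ k := by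
  induction k using Fin.lastCases with
  | last => simpa [durations] using h.2
  | cast k => simpa [durations] using h.1 k

theorem timeSimplex_of_nonpos {n : ℕ} {s : ℝ} (hs : s ≤ 0) : timeSimplex n s = ∅ := by
  ext τ
  simp only [Set.mem_empty_iff_false, iff_false]
  exact fun h => (Finset.sum_nonneg fun i _ => (h.1 i).le).not_gt (h.2.trans_le hs)

theorem measurable_durations {n : ℕ} (s : ℝ) (k : Fin (n + 1)) :
    Measurable fun τ : Fin n → ℝ => durations s τ k := by
  induction k using Fin.lastCases with
  | last => simp only [durations, Fin.snoc_last]; fun_prop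
  | cast k => simp only [durations, Fin.snoc_castSucc]; fun_prop

theorem measurableSet_timeSimplex (n : ℕ) (s : ℝ) : MeasurableSet (timeSimplex n s) := by
  have : timeSimplex n s = (⋂ i, {τ | 0 < τ i}) ∩ {τ | ∑ i, τ i < s} := by
    ext τ
    simp [timeSimplex]
  rw [this]
  exact (MeasurableSet.iInter fun i => measurableSet_lt measurable_const (by fun_prop)).inter
    (measurableSet_lt (by fun_prop) measurable_const)

/-- The Dirichlet integral. -/
theorem lintegral_timeSimplex_prod_rpow (n : ℕ) {b : Fin (n + 1) → ℝ} (hb : ∀ k, 0 < b k)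
    {s : ℝ} (hs : 0 < s) :
    ∫⁻ τ in timeSimplex n s, ∏ k, ENNReal.ofReal (durations s τ k ^ (b k - 1)) =
      ENNReal.ofReal (s ^ (∑ k, b k - 1) *
        ((∏ k, Real.Gamma (b k)) / Real.Gamma (∑ k, b k))) := by
  induction n generalizing s with
  | zero =>
    have h : timeSimplex 0 s = Set.univ := by
      ext τ
      simp [timeSimplex, hs]
    have h0 : Real.Gamma (b 0) ≠ 0 := (Real.Gamma_pos_of_pos (hb 0)).ne'
    rw [h, Measure.restrict_univ, volume_pi, Measure.pi_of_empty, lintegral_dirac]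
    simp [durations, h0, Fin.snoc]
  | succ n ih =>
    have mp := (volume_preserving_piFinSuccAbove (fun _ : Fin (n + 1) => ℝ) 0).symm
    have hcons : ∀ p : ℝ × (Fin n → ℝ),
        (MeasurableEquiv.piFinSuccAbove (fun _ : Fin (n + 1) => ℝ) 0).symm p =
          Fin.cons p.1 p.2 := fun p => by
      simp [MeasurableEquiv.piFinSuccAbove, Fin.insertNthEquiv]
    set B := ∑ k : Fin (n + 1), b k.succ with hB
    have hBpos : 0 < B := Finset.sum_pos (fun k _ => hb k.succ) Finset.univ_nonempty
    set G := ∏ k : Fin (n + 1), Real.Gamma (b k.succ) with hG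
    have hGpos : 0 < G := Finset.prod_pos fun k _ => Real.Gamma_pos_of_pos (hb k.succ)
    have hmeas : Measurable ((timeSimplex (n + 1) s).indicator fun τ : Fin (n + 1) → ℝ =>
        ∏ k, ENNReal.ofReal (durations s τ k ^ (b k - 1))) :=
      (Finset.measurable_fun_prod _ fun k _ =>
        ((measurable_durations s k).pow_const _).ennreal_ofReal).indicator
        (measurableSet_timeSimplex _ _)
    have hmeas' := hmeas.comp
      (MeasurableEquiv.piFinSuccAbove (fun _ : Fin (n + 1) => ℝ) 0).symm.measurable
    rw [← lintegral_indicator (measurableSet_timeSimplex _ _),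
      ← mp.lintegral_comp_emb (MeasurableEquiv.measurableEmbedding _), Measure.volume_eq_prod,
      lintegral_prod _ (by exact hmeas'.aemeasurable)]
    -- With the first duration `x` fixed, the rest is a Dirichlet integral over the simplex of size
    -- `s - x`. It yields a power of `s - x`, hence a beta integral in `x`, whose factor `Γ(B)`
    -- cancels the denominator.
    have hinner : ∀ x : ℝ, ∫⁻ τ : Fin n → ℝ, (timeSimplex (n + 1) s).indicator
        (fun τ : Fin (n + 1) → ℝ => ∏ k, ENNReal.ofReal (durations s τ k ^ (b k - 1)))
          ((MeasurableEquiv.piFinSuccAbove (fun _ : Fin (n + 1) => ℝ) 0).symm (x, τ)) =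
        (Set.Ioo 0 s).indicator (fun x => ENNReal.ofReal (G / Real.Gamma B) *
          (ENNReal.ofReal (x ^ (b 0 - 1)) * ENNReal.ofReal ((s - x) ^ (B - 1)))) x := by
      intro x
      simp only [hcons]
      by_cases hx : x ∈ Set.Ioo 0 s
      · rw [Set.indicator_of_mem hx]
        have h : ∀ τ : Fin n → ℝ, (timeSimplex (n + 1) s).indicator
            (fun τ : Fin (n + 1) → ℝ => ∏ k, ENNReal.ofReal (durations s τ k ^ (b k - 1)))
              (Fin.cons x τ) = ENNReal.ofReal (x ^ (b 0 - 1)) *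
            (timeSimplex n (s - x)).indicator (fun τ => ∏ k : Fin (n + 1),
              ENNReal.ofReal (durations (s - x) τ k ^ (b k.succ - 1))) τ := by
          intro τ
          by_cases hτ : τ ∈ timeSimplex n (s - x)
          · rw [Set.indicator_of_mem hτ, Set.indicator_of_mem (cons_mem_timeSimplex.2 ⟨hx.1, hτ⟩),
              durations_cons, Fin.prod_univ_succ]
            simp
          · rw [Set.indicator_of_notMem hτ, mul_zero,
              Set.indicator_of_notMem fun h => hτ (cons_mem_timeSimplex.1 h).2]
        simp_rw [h]
        rw [lintegral_const_mul' _ _ ENNReal.ofReal_ne_top,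
          lintegral_indicator (measurableSet_timeSimplex _ _),
          ih (fun k => hb k.succ) (sub_pos.2 hx.2), ← hB, ← hG,
          ENNReal.ofReal_mul (Real.rpow_nonneg (sub_pos.2 hx.2).le _)]
        ring
      · rw [Set.indicator_of_notMem hx]
        refine (lintegral_congr fun τ => Set.indicator_of_notMem (fun h => ?_) _).trans
          lintegral_zero
        obtain ⟨h0, h1⟩ := cons_mem_timeSimplex.1 h
        have hsx : s - x ≤ 0 := by
          by_contra hc
          exact hx ⟨h0, by linarith⟩
        rw [timeSimplex_of_nonpos hsx] at h1
        exact h1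
    rw [lintegral_congr hinner, lintegral_indicator measurableSet_Ioo,
      lintegral_const_mul' _ _ ENNReal.ofReal_ne_top, lintegral_rpow_mul_sub_rpow (hb 0) hBpos hs,
      ← ENNReal.ofReal_mul (by have := Real.Gamma_pos_of_pos hBpos; positivity),
      Fin.sum_univ_succ, Fin.prod_univ_succ, ← hB, ← hG, beta]
    have := Real.Gamma_pos_of_pos hBpos
    congr 1
    field_simp

/-- Multiplying the Dirichlet density by a monomial shifts its parameters by the exponents; the
quotients of Gamma values are Pochhammer symbols. -/
theorem integral_timeLaw_prod_pow {n d : ℕ} {ν t : ℝ} (hν : 0 ≤ ν) (hd : 2 ≤ d) (ht : 0 < t)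
    (j : Fin (n + 1) → ℕ) :
    ∫ τ, ∏ k, durations t τ k ^ j k ∂timeLaw n d ν t =
      t ^ (∑ k, j k) * ((∏ k, (ascPochhammer ℝ (j k)).eval (2 * ν + d - 1)) /
        (ascPochhammer ℝ (∑ k, j k)).eval (((n : ℝ) + 1) * (2 * ν + d - 1))) := by
  have hd' : (2 : ℝ) ≤ d := by exact_mod_cast hd
  set a : ℝ := 2 * ν + d - 1 with ha
  have hapos : 0 < a := by linarith
  have hA : 0 < ((n : ℝ) + 1) * a := by positivity
  have hG := Real.Gamma_pos_of_pos hapos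
  have hGA := Real.Gamma_pos_of_pos hA
  have hasc : 0 < (ascPochhammer ℝ (∑ k, j k)).eval (((n : ℝ) + 1) * a) := ascPochhammer_pos _ _ hA
  set K : ℝ := Real.Gamma (((n : ℝ) + 1) * a) / Real.Gamma a ^ (n + 1) /
    t ^ (((n : ℝ) + 1) * a - 1) with hK
  have hKpos : 0 < K := by positivity
  have hm : ∀ k, Measurable fun τ : Fin n → ℝ => durations t τ k := measurable_durations t
  have hdens : Measurable fun τ : Fin n → ℝ => ENNReal.ofReal (timeDensity n d ν t τ) := by
    unfold timeDensity
    fun_prop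
  have hg : Measurable fun τ : Fin n → ℝ => ∏ k, durations t τ k ^ j k := by fun_prop
  have hnonneg : 0 ≤ᵐ[timeLaw n d ν t] fun τ => ∏ k, durations t τ k ^ j k := by
    refine (withDensity_absolutelyContinuous _ _).ae_le ?_
    filter_upwards [ae_restrict_mem (measurableSet_timeSimplex n t)] with τ hτ
    exact Finset.prod_nonneg fun k _ => pow_nonneg (durations_pos hτ k).le _
  rw [integral_eq_lintegral_of_nonneg_ae hnonneg hg.aestronglyMeasurable, timeLaw,
    lintegral_withDensity_eq_lintegral_mul _ hdens hg.ennreal_ofReal]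
  have hcongr : ∀ τ ∈ timeSimplex n t,
      ((fun τ => ENNReal.ofReal (timeDensity n d ν t τ)) *
        fun τ => ENNReal.ofReal (∏ k, durations t τ k ^ j k)) τ =
      ENNReal.ofReal K * ∏ k, ENNReal.ofReal (durations t τ k ^ ((a + j k) - 1)) := by
    intro τ hτ
    have hpos := durations_pos hτ
    have hprod : ∏ k, durations t τ k ^ ((a + j k) - 1) =
        (∏ k, durations t τ k ^ (2 * ν + d - 2)) * ∏ k, durations t τ k ^ j k := by
      rw [← Finset.prod_mul_distrib]
      refine Finset.prod_congr rfl fun k _ => ?_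
      rw [← Real.rpow_add_natCast (hpos k).ne', ha]
      congr 1
      ring
    have hp : 0 ≤ ∏ k, durations t τ k ^ (2 * ν + d - 2) :=
      Finset.prod_nonneg fun k _ => Real.rpow_nonneg (hpos k).le _
    rw [← ENNReal.ofReal_prod_of_nonneg fun k _ => Real.rpow_nonneg (hpos k).le _, hprod,
      ← ENNReal.ofReal_mul hKpos.le, Pi.mul_apply, timeDensity, ← ha,
      ← ENNReal.ofReal_mul (by positivity), hK]
    congr 1
    ring
  have hsum : ∑ k, (a + j k) = ((n : ℝ) + 1) * a + (∑ k, j k : ℕ) := by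
    rw [Finset.sum_add_distrib]
    simp
  rw [setLIntegral_congr_fun (measurableSet_timeSimplex n t) hcongr,
    lintegral_const_mul' _ _ ENNReal.ofReal_ne_top,
    lintegral_timeSimplex_prod_rpow n (fun k => by positivity) ht, hsum,
    ← ENNReal.ofReal_mul hKpos.le, ENNReal.toReal_ofReal]
  · simp_rw [Gamma_add_natCast hapos]
    rw [Gamma_add_natCast hA, Finset.prod_mul_distrib, Finset.prod_const, Finset.card_univ,
      Fintype.card_fin, hK, add_sub_right_comm, Real.rpow_add_natCast ht.ne']
    field_simp
  · have h1 : 0 < ((n : ℝ) + 1) * a + (∑ k, j k : ℕ) := by positivity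
    have h2 := Real.Gamma_pos_of_pos h1
    have h3 : 0 ≤ ∏ k, Real.Gamma (a + j k) :=
      Finset.prod_nonneg fun k _ => (Real.Gamma_pos_of_pos (by positivity)).le
    positivity

/-! ### The law of one direction. -/

theorem abs_sphereCoord_le_one (e : ℕ) (θ : Fin e → ℝ) (i : Fin e) : |sphereCoord e θ i| ≤ 1 := by
  rw [sphereCoord, abs_mul, Finset.abs_prod]
  refine mul_le_one₀ (Finset.prod_le_one (fun _ _ => abs_nonneg _) fun j _ => ?_) (abs_nonneg _)
    (Real.abs_cos_le_one _)
  split_ifs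
  · exact Real.abs_sin_le_one _
  · simp

theorem abs_sum_mul_sphereCoord_le {e : ℕ} (α θ : Fin e → ℝ) :
    |∑ i, α i * sphereCoord e θ i| ≤ ∑ i, |α i| := by
  refine (Finset.abs_sum_le_sum_abs _ _).trans (Finset.sum_le_sum fun i _ => ?_)
  rw [abs_mul]
  exact mul_le_of_le_one_right (abs_nonneg _) (abs_sphereCoord_le_one _ _ _)

theorem measurable_sphereCoord (e : ℕ) (i : Fin e) :
    Measurable fun θ : Fin e → ℝ => sphereCoord e θ i := by
  unfold sphereCoord
  refine Measurable.mul (Finset.measurable_fun_prod _ fun j _ => ?_) (by fun_prop)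
  split_ifs <;> fun_prop

theorem measurableSet_angleBox (d : ℕ) : MeasurableSet (angleBox d) := by
  have : angleBox d = Set.univ.pi fun j : Fin (d - 1) =>
      Set.Icc 0 (if (j : ℕ) + 1 = d - 1 then 2 * Real.pi else Real.pi) := by
    ext θ
    simp only [angleBox, Set.mem_ofPred_eq, Set.mem_univ_pi, Set.mem_Icc]
  rw [this]
  exact MeasurableSet.univ_pi fun _ => measurableSet_Icc

/-- The angle of index `j` has `r = d - 1 - j`, so `2ν + r - 1 = 2ν + d - 2 - j`; `r = 1` marks the
last angle. -/
theorem indicator_angleBox_angleDensity {d : ℕ} (hd : 2 ≤ d) (ν : ℝ) (θ : Fin (d - 1) → ℝ) :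
    (angleBox d).indicator (angleDensity d ν) θ =
      Real.Gamma (ν + d / 2) / (2 * Real.pi ^ (((d : ℝ) - 1) / 2) * Real.Gamma (ν + 1 / 2)) *
        sphereWeight ν (d - 1) θ := by
  have hif : ∀ j : Fin (d - 1), ((j : ℕ) + 1 = d - 1) ↔ (d - 1 - (j : ℕ) = 1) := fun j => by
    have := j.2
    omega
  by_cases h : θ ∈ angleBox d
  · rw [Set.indicator_of_mem h, angleDensity, sphereWeight]
    congr 1
    refine Finset.prod_congr rfl fun j _ => ?_
    rw [angleWeight, Set.indicator_of_mem]
    · congr 1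
      rw [Nat.cast_sub j.2.le, Nat.cast_sub (by omega)]
      push_cast
      ring
    · have := h j
      simp only [hif] at this
      exact this
  · rw [Set.indicator_of_notMem h, eq_comm, mul_eq_zero]
    refine Or.inr ?_
    simp only [angleBox, Set.mem_ofPred_eq, not_forall] at h
    obtain ⟨j, hj⟩ := h
    refine Finset.prod_eq_zero (Finset.mem_univ j) (Set.indicator_of_notMem (fun h' => hj ?_) _)
    simp only [hif]
    exact h'

theorem integral_angleLaw {d : ℕ} (hd : 2 ≤ d) {ν : ℝ} (hν : 0 ≤ ν) (f : (Fin (d - 1) → ℝ) → ℝ) :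
    ∫ θ, f θ ∂angleLaw d ν =
      Real.Gamma (ν + d / 2) / (2 * Real.pi ^ (((d : ℝ) - 1) / 2) * Real.Gamma (ν + 1 / 2)) *
        ∫ θ, sphereWeight ν (d - 1) θ * f θ := by
  have hpos : ∀ θ, 0 ≤ angleDensity d ν θ := fun θ => by
    have h1 := Real.Gamma_pos_of_pos (show 0 < ν + d / 2 by positivity)
    have h2 := Real.Gamma_pos_of_pos (show 0 < ν + 1 / 2 by positivity)
    have h3 : 0 ≤ ∏ j : Fin (d - 1), |Real.sin (θ j)| ^ (2 * ν + d - 2 - ((j : ℕ) : ℝ)) :=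
      Finset.prod_nonneg fun j _ => Real.rpow_nonneg (abs_nonneg _) _
    unfold angleDensity
    positivity
  have hm : Measurable (angleDensity d ν) := by
    unfold angleDensity
    fun_prop
  rw [angleLaw, integral_withDensity_eq_integral_toReal_smul hm.ennreal_ofReal
    (Filter.Eventually.of_forall fun _ => ENNReal.ofReal_lt_top),
    ← integral_indicator (measurableSet_angleBox d), ← integral_const_mul]
  refine integral_congr_ae (Filter.Eventually.of_forall fun θ => ?_)
  simp only [ENNReal.toReal_ofReal (hpos _), smul_eq_mul]
  rw [← mul_assoc, ← indicator_angleBox_angleDensity hd]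
  by_cases hθ : θ ∈ angleBox d <;> simp [hθ]

/-- The explicit constant times `C` equals `1`, as the case `N = 0` is the total mass of a
probability measure; neither factor has to be evaluated. -/
theorem integral_angleLaw_pow {d : ℕ} (hd : 2 ≤ d) {ν : ℝ} (hν : 0 ≤ ν)
    [IsProbabilityMeasure (angleLaw d ν)] (α : Fin (d - 1) → ℝ) (N : ℕ) :
    ∫ θ, (∑ i, α i * sphereCoord (d - 1) θ i) ^ N ∂angleLaw d ν =
      (∑ i, α i ^ 2) ^ (N / 2) * besselMoment (ν + (d : ℝ) / 2 - 1) N := by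
  obtain ⟨C, hC⟩ := exists_integral_sphereWeight_mul_pow hν (d - 1)
  have h1 : ∫ _, (1 : ℝ) ∂angleLaw d ν = 1 := by simp
  have h2 := (hC 0 0).2
  simp only [pow_zero, Nat.zero_div, besselMoment_zero, mul_one] at h2
  rw [integral_angleLaw hd hν] at h1
  simp only [mul_one] at h1
  rw [h2] at h1
  rw [integral_angleLaw hd hν, (hC N α).2, ← mul_assoc, h1, one_mul, Nat.cast_sub (by omega),
    show ν + ((d : ℝ) - (1 : ℕ) - 1) / 2 = ν + (d : ℝ) / 2 - 1 by push_cast; ring]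

theorem sum_durations {n : ℕ} (t : ℝ) (τ : Fin n → ℝ) : ∑ k, durations t τ k = t := by
  simp [durations, Fin.sum_univ_castSucc]

/-- The truncated half matters only for odd `N`, where the moment vanishes. -/
theorem pow_div_two_mul_besselMoment (l x : ℝ) (N : ℕ) :
    (x ^ 2) ^ (N / 2) * besselMoment l N = x ^ N * besselMoment l N := by
  rcases Nat.even_or_odd' N with ⟨n, rfl | rfl⟩
  · rw [Nat.mul_div_cancel_left n two_pos, pow_mul]
  · simp [besselMoment_of_odd _ (odd_two_mul_add_one n)]

/-! ### Moments of the flight. -/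

section Flight

variable {Ω : Type*} [MeasurableSpace Ω] {P : Measure Ω} {n d : ℕ}
  {ν t : ℝ} {τ : Ω → Fin n → ℝ} {θ : Fin (n + 1) → Ω → Fin (d - 1) → ℝ}

theorem IsRandomFlight.ae_mem_timeSimplex (h : IsRandomFlight P n d ν t τ θ) :
    ∀ᵐ ω ∂P, τ ω ∈ timeSimplex n t := by
  rw [h.hasLaw_time.ae_iff (p := fun x => x ∈ timeSimplex n t)
    (measurableSet_setOfPred.1 (measurableSet_timeSimplex n t))]
  exact (withDensity_absolutelyContinuous _ _).ae_le
    (ae_restrict_mem (measurableSet_timeSimplex n t))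

theorem IsRandomFlight.ae_abs_sum_le (h : IsRandomFlight P n d ν t τ θ) (α : Fin (d - 1) → ℝ) :
    ∀ᵐ ω ∂P, |∑ k, durations t (τ ω) k * ∑ i, α i * sphereCoord (d - 1) (θ k ω) i| ≤
      t * ∑ i, |α i| := by
  filter_upwards [h.ae_mem_timeSimplex] with ω hω
  rw [← sum_durations t (τ ω), Finset.sum_mul, sum_durations]
  refine (Finset.abs_sum_le_sum_abs _ _).trans (Finset.sum_le_sum fun k _ => ?_)
  rw [abs_mul, abs_of_pos (durations_pos hω k)]
  exact mul_le_mul_of_nonneg_left (abs_sum_mul_sphereCoord_le _ _) (durations_pos hω k).le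

theorem IsRandomFlight.aemeasurable_duration (h : IsRandomFlight P n d ν t τ θ)
    (k : Fin (n + 1)) : AEMeasurable (fun ω => durations t (τ ω) k) P :=
  (measurable_durations t k).comp_aemeasurable h.hasLaw_time.aemeasurable

theorem IsRandomFlight.aemeasurable_sphereCoord (h : IsRandomFlight P n d ν t τ θ)
    (k : Fin (n + 1)) (i : Fin (d - 1)) :
    AEMeasurable (fun ω => sphereCoord (d - 1) (θ k ω) i) P :=
  (measurable_sphereCoord _ i).comp_aemeasurable (h.hasLaw_angle k).aemeasurable

theorem IsRandomFlight.integral_prod_pow [IsProbabilityMeasure P]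
    (h : IsRandomFlight P n d ν t τ θ) (hd : 2 ≤ d)
    (hν : 0 ≤ ν) (ht : 0 < t) (α : Fin (d - 1) → ℝ) (j : Fin (n + 1) → ℕ) :
    ∫ ω, ∏ k, (durations t (τ ω) k * ∑ i, α i * sphereCoord (d - 1) (θ k ω) i) ^ j k ∂P =
      (t ^ (∑ k, j k) * ((∏ k, (ascPochhammer ℝ (j k)).eval (2 * ν + d - 1)) /
        (ascPochhammer ℝ (∑ k, j k)).eval (((n : ℝ) + 1) * (2 * ν + d - 1)))) *
      ∏ k, (Real.sqrt (∑ i, α i ^ 2) ^ j k * besselMoment (ν + (d : ℝ) / 2 - 1) (j k)) := by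
  have hmT : Measurable fun x : Fin n → ℝ => ∏ k, durations t x k ^ j k :=
    Finset.measurable_fun_prod _ fun k _ => (measurable_durations t k).pow_const _
  have hmY : Measurable fun x : Fin (d - 1) → ℝ => ∑ i, α i * sphereCoord (d - 1) x i :=
    Finset.measurable_fun_sum _ fun i _ => (measurable_sphereCoord _ i).const_mul _
  have hmYs : Measurable fun x : Fin (n + 1) → Fin (d - 1) → ℝ =>
      ∏ k, (∑ i, α i * sphereCoord (d - 1) (x k) i) ^ j k :=
    Finset.measurable_fun_prod _ fun k _ => (hmY.comp (measurable_pi_apply k)).pow_const _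
  simp only [mul_pow, Finset.prod_mul_distrib]
  have hT : ∫ ω, ∏ k, durations t (τ ω) k ^ j k ∂P =
      ∫ x, ∏ k, durations t x k ^ j k ∂timeLaw n d ν t :=
    h.hasLaw_time.integral_comp hmT.aestronglyMeasurable
  -- The normalisation of the angular density is inherited from `P`, since the angles have this law.
  have hprob : IsProbabilityMeasure (angleLaw d ν) :=
    (h.hasLaw_angle 0).isProbabilityMeasure_iff.1 inferInstance
  have hY : ∀ k, ∫ ω, (∑ i, α i * sphereCoord (d - 1) (θ k ω) i) ^ j k ∂P =
      Real.sqrt (∑ i, α i ^ 2) ^ j k * besselMoment (ν + (d : ℝ) / 2 - 1) (j k) := fun k => by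
    rw [← pow_div_two_mul_besselMoment, Real.sq_sqrt (Finset.sum_nonneg fun i _ => sq_nonneg _),
      ← integral_angleLaw_pow hd hν]
    exact (h.hasLaw_angle k).integral_comp (hmY.pow_const _).aestronglyMeasurable
  have hYs := h.iIndepFun_angle.integral_fun_prod_comp
    (f := fun k x => (∑ i, α i * sphereCoord (d - 1) x i) ^ j k)
    (fun k => (h.hasLaw_angle k).aemeasurable)
    (fun k => (hmY.pow_const _).aestronglyMeasurable)
  have hind : ∫ ω, (∏ k, durations t (τ ω) k ^ j k) *
      ∏ k, (∑ i, α i * sphereCoord (d - 1) (θ k ω) i) ^ j k ∂P =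
      (∫ ω, ∏ k, durations t (τ ω) k ^ j k ∂P) *
        ∫ ω, ∏ k, (∑ i, α i * sphereCoord (d - 1) (θ k ω) i) ^ j k ∂P :=
    (h.indepFun_time_angle.comp hmT hmYs).integral_fun_mul_eq_mul_integral
      (hmT.comp_aemeasurable h.hasLaw_time.aemeasurable).aestronglyMeasurable
      (hmYs.comp_aemeasurable (aemeasurable_pi_lambda _ fun k =>
        (h.hasLaw_angle k).aemeasurable)).aestronglyMeasurable
  rw [hind, hT, hYs, integral_timeLaw_prod_pow hν hd ht, Finset.prod_congr rfl fun k _ => hY k,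
    Finset.prod_mul_distrib]

theorem IsRandomFlight.integral_sum_pow [IsProbabilityMeasure P]
    (h : IsRandomFlight P n d ν t τ θ) (hd : 2 ≤ d)
    (hν : 0 ≤ ν) (ht : 0 < t) (α : Fin (d - 1) → ℝ) {μ : ℝ}
    (hμ : μ = ((n : ℝ) + 1) / 2 * (2 * ν + d - 1) - 1 / 2) (N : ℕ) :
    ∫ ω, (∑ k, durations t (τ ω) k * ∑ i, α i * sphereCoord (d - 1) (θ k ω) i) ^ N ∂P =
      (t * Real.sqrt (∑ i, α i ^ 2)) ^ N * besselMoment μ N := by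
  have hd' : (2 : ℝ) ≤ d := by exact_mod_cast hd
  have hl : 0 ≤ ν + (d : ℝ) / 2 - 1 := by linarith
  have hmeas : ∀ k, AEMeasurable
      (fun ω => durations t (τ ω) k * ∑ i, α i * sphereCoord (d - 1) (θ k ω) i) P := fun k =>
    (h.aemeasurable_duration k).mul
      (Finset.aemeasurable_fun_sum _ fun i _ => (h.aemeasurable_sphereCoord k i).const_mul _)
  have hbound : ∀ k, ∀ᵐ ω ∂P,
      |durations t (τ ω) k * ∑ i, α i * sphereCoord (d - 1) (θ k ω) i| ≤ t * ∑ i, |α i| := by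
    intro k
    filter_upwards [h.ae_mem_timeSimplex] with ω hω
    rw [abs_mul, abs_of_pos (durations_pos hω k)]
    have h1 : durations t (τ ω) k ≤ t := by
      conv_rhs => rw [← sum_durations t (τ ω)]
      exact Finset.single_le_sum (fun i _ => (durations_pos hω i).le) (Finset.mem_univ k)
    exact mul_le_mul h1 (abs_sum_mul_sphereCoord_le _ _) (abs_nonneg _) ht.le
  simp only [Finset.sum_pow_eq_sum_piAntidiag]
  rw [integral_finsetSum]
  -- For this `l`, the order of one direction, `2 * l + 1` is exactly the Dirichlet parameter `2ν +
  -- d - 1`.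
  · rw [← sum_multinomial_mul_besselMoment (l := ν + (d : ℝ) / 2 - 1) hl n (by rw [hμ]; ring) N,
      Finset.mul_sum]
    refine Finset.sum_congr rfl fun j hj => ?_
    have hj : ∑ k, j k = N := (Finset.mem_piAntidiag.1 hj).1
    rw [integral_const_mul, h.integral_prod_pow hd hν ht, Finset.prod_mul_distrib,
      Finset.prod_pow_eq_pow_sum, hj, mul_pow,
      show 2 * (ν + (d : ℝ) / 2 - 1) + 1 = 2 * ν + d - 1 by ring]
    ring
  · intro j _
    refine Integrable.const_mul (Integrable.of_bound
      (Finset.aemeasurable_fun_prod _ fun k _ => (hmeas k).pow_const _).aestronglyMeasurable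
      (∏ k, (t * ∑ i, |α i|) ^ j k) ?_) _
    filter_upwards [ae_all_iff.2 hbound] with ω hω
    rw [Real.norm_eq_abs, Finset.abs_prod]
    refine Finset.prod_le_prod (fun _ _ => abs_nonneg _) fun k _ => ?_
    rw [abs_pow]
    exact pow_le_pow_left₀ (abs_nonneg _) (hω k) _

end Flight

/-! ### From moments to the characteristic function. -/

/-- The characteristic function of a bounded random variable as a moment series. -/
theorem hasSum_integral_exp_mul_I {Ω : Type*} [MeasurableSpace Ω] {P : Measure Ω}
    [IsProbabilityMeasure P] {Z : Ω → ℝ} (hZ : AEMeasurable Z P) {B : ℝ}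
    (hB : ∀ᵐ ω ∂P, |Z ω| ≤ B) :
    HasSum (fun N : ℕ => Complex.I ^ N / N.factorial * ((∫ ω, Z ω ^ N ∂P : ℝ) : ℂ))
      (∫ ω, Complex.exp (Z ω * Complex.I) ∂P) := by
  have h := hasSum_integral_of_dominated_convergence (μ := P)
    (F := fun (N : ℕ) ω => Complex.I ^ N / N.factorial * ((Z ω ^ N : ℝ) : ℂ))
    (f := fun ω => Complex.exp (Z ω * Complex.I))
    (fun N _ => B ^ N / N.factorial)
    (fun N => (Complex.measurable_ofReal.comp_aemeasurable
      (hZ.pow_const N)).aestronglyMeasurable.const_mul _)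
    (fun N => by
      filter_upwards [hB] with ω hω
      rw [norm_mul, norm_div, norm_pow, Complex.norm_I, one_pow, Complex.norm_natCast,
        Complex.norm_real, Real.norm_eq_abs, abs_pow, one_div_mul_eq_div]
      gcongr)
    (Filter.Eventually.of_forall fun _ => Real.summable_pow_div_factorial B)
    (integrable_const _)
    (Filter.Eventually.of_forall fun ω => by
      have := NormedSpace.expSeries_div_hasSum_exp ((Z ω : ℂ) * Complex.I)
      rw [← Complex.exp_eq_exp_ℂ] at this
      refine this.congr_fun ?_
      intro N
      push_cast
      rw [mul_pow]
      ring)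
  simpa only [integral_const_mul, integral_complex_ofReal] using h

/-- Odd terms vanish. In the term `N = 2 * k` the factorial `(2k)!` cancels, and `(μ + 1)_k * Γ(μ +
1) = Γ(k + μ + 1)` gives the Bessel coefficient. -/
theorem hasSum_besselMoment {μ r : ℝ} (hμ : 0 ≤ μ) (hr : 0 < r) {z : ℂ}
    (h : HasSum (fun N : ℕ => Complex.I ^ N / N.factorial * ((r ^ N * besselMoment μ N : ℝ) : ℂ)) z) :
    z = ((2 ^ μ * Real.Gamma (μ + 1) / r ^ μ * besselJ μ r : ℝ) : ℂ) := by
  have hinj : Function.Injective fun k : ℕ => 2 * k := mul_right_injective₀ two_ne_zero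
  rw [← hinj.hasSum_iff] at h
  · rw [besselJ, ← tsum_mul_left, Complex.ofReal_tsum, ← h.tsum_eq]
    refine tsum_congr fun k => ?_
    have h1 : 0 < (ascPochhammer ℝ k).eval (μ + 1) := ascPochhammer_pos _ _ (by positivity)
    have h2 := Real.Gamma_pos_of_pos (show 0 < μ + 1 by positivity)
    have h3 : (r / 2) ^ (2 * (k : ℝ) + μ) = r ^ (2 * k) / 4 ^ k * (r ^ μ / 2 ^ μ) := by
      rw [Real.rpow_add (by positivity), Real.div_rpow hr.le two_pos.le μ,
        show 2 * (k : ℝ) = ((2 * k : ℕ) : ℝ) by push_cast; ring, Real.rpow_natCast, div_pow,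
        pow_mul 2]
      norm_num
    have h4 : (k : ℝ) + μ + 1 = (μ + 1) + k := by ring
    have h5 := Real.rpow_pos_of_pos hr μ
    have h6 := Real.rpow_pos_of_pos two_pos μ
    rw [Function.comp_apply, besselMoment_two_mul, h3, h4, Gamma_add_natCast (by positivity),
      pow_mul, Complex.I_sq, ← Complex.ofReal_natCast, ← Complex.ofReal_one, ← Complex.ofReal_neg,
      ← Complex.ofReal_pow, ← Complex.ofReal_div, ← Complex.ofReal_mul]
    congr 1
    field_simp
  · intro N hN
    have : Odd N := by
      rw [← Nat.not_even_iff_odd]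
      rintro ⟨k, rfl⟩
      exact hN ⟨k, (two_mul k)⟩
    simp [besselMoment_of_odd _ this]

theorem firstCoords_flightPosition_apply {n d m : ℕ} (hmd : m < d) (c t : ℝ) (τ : Fin n → ℝ)
    (θ : Fin (n + 1) → Fin (d - 1) → ℝ) (i : Fin m) :
    firstCoords hmd.le (flightPosition d c t τ θ) i =
      c * ∑ k, durations t τ k *
        sphereCoord (d - 1) (θ k) (Fin.castLE (Nat.le_sub_one_of_lt hmd) i) := by
  have hi : (i : ℕ) < d - 1 := by omega
  simp [firstCoords, flightPosition, direction, sphereCoord, hi]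
  -- Cancelling the common factor `c` leaves the alternative that the sums agree or `c = 0`.
  exact Or.inl rfl

/-- Extending `α` by zero to `d - 1` coordinates reduces every `m < d` to the single case `m = d -
1`. -/
theorem inner_firstCoords_flightPosition {n d m : ℕ} (hmd : m < d) (c t : ℝ) (τ : Fin n → ℝ)
    (θ : Fin (n + 1) → Fin (d - 1) → ℝ) (α : EuclideanSpace ℝ (Fin m)) (β : Fin (d - 1) → ℝ)
    (hβ : β = Function.extend (Fin.castLE (Nat.le_sub_one_of_lt hmd)) α 0) :
    inner ℝ (firstCoords hmd.le (flightPosition d c t τ θ)) α =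
      c * ∑ k, durations t τ k * ∑ i, β i * sphereCoord (d - 1) (θ k) i := by
  have hinj := Fin.castLE_injective (Nat.le_sub_one_of_lt hmd)
  have h : ∀ k, ∑ i, β i * sphereCoord (d - 1) (θ k) i =
      ∑ i, α i * sphereCoord (d - 1) (θ k) (Fin.castLE (Nat.le_sub_one_of_lt hmd) i) := by
    intro k
    refine (Fintype.sum_of_injective _ hinj _ _ (fun i hi => ?_) fun i => ?_).symm
    · rw [hβ, Function.extend_apply' _ _ _ (fun ⟨a, ha⟩ => hi ⟨a, ha⟩)]
      simp
    · rw [hβ, hinj.extend_apply]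
  simp only [PiLp.inner_apply, firstCoords_flightPosition_apply hmd, h, RCLike.inner_apply,
    conj_trivial, Finset.mul_sum]
  rw [Finset.sum_comm]
  refine Finset.sum_congr rfl fun k _ => Finset.sum_congr rfl fun i _ => ?_
  ring

theorem IsRandomFlight.aemeasurable_firstCoords {Ω : Type*} [MeasurableSpace Ω] {P : Measure Ω}
    [IsProbabilityMeasure P] {n d m : ℕ} {ν t : ℝ} {τ : Ω → Fin n → ℝ}
    {θ : Fin (n + 1) → Ω → Fin (d - 1) → ℝ} (h : IsRandomFlight P n d ν t τ θ) (hmd : m < d)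
    (c : ℝ) : AEMeasurable
      (fun ω => firstCoords hmd.le (flightPosition d c t (τ ω) fun k => θ k ω)) P := by
  have : (fun ω => firstCoords hmd.le (flightPosition d c t (τ ω) fun k => θ k ω)) =
      fun ω => WithLp.toLp 2 fun i : Fin m => c * ∑ k, durations t (τ ω) k *
        sphereCoord (d - 1) (θ k ω) (Fin.castLE (Nat.le_sub_one_of_lt hmd) i) := by
    ext ω i
    exact firstCoords_flightPosition_apply hmd c t (τ ω) (fun k => θ k ω) i
  rw [this]
  exact (WithLp.measurable_toLp 2 _).comp_aemeasurable (aemeasurable_pi_lambda _ fun i =>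
    (Finset.aemeasurable_fun_sum _ fun k _ =>
      (h.aemeasurable_duration k).mul (h.aemeasurable_sphereCoord k _)).const_mul _)

theorem charFun_firstCoords_flightPosition {Ω : Type*} [MeasurableSpace Ω] {P : Measure Ω}
    [IsProbabilityMeasure P] {n d m : ℕ} (hd : 2 ≤ d) (hmd : m < d) {ν c t : ℝ} (hν : 0 ≤ ν)
    (hc : 0 < c) (ht : 0 < t) {τ : Ω → Fin n → ℝ} {θ : Fin (n + 1) → Ω → Fin (d - 1) → ℝ}
    (h : IsRandomFlight P n d ν t τ θ) {μ : ℝ}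
    (hμ : μ = ((n : ℝ) + 1) / 2 * (2 * ν + d - 1) - 1 / 2) {α : EuclideanSpace ℝ (Fin m)}
    (hα : α ≠ 0) :
    charFun (P.map fun ω => firstCoords hmd.le (flightPosition d c t (τ ω) fun k => θ k ω)) α =
      ((2 ^ μ * Real.Gamma (μ + 1) / (c * t * ‖α‖) ^ μ * besselJ μ (c * t * ‖α‖) : ℝ) : ℂ) := by
  have hd' : (2 : ℝ) ≤ d := by exact_mod_cast hd
  have hμ0 : 0 ≤ μ := by rw [hμ]; nlinarith [Nat.cast_nonneg (α := ℝ) n]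
  have hX := h.aemeasurable_firstCoords hmd c
  set β : Fin (d - 1) → ℝ := Function.extend (Fin.castLE (Nat.le_sub_one_of_lt hmd)) α 0 with hβ
  have hinj := Fin.castLE_injective (Nat.le_sub_one_of_lt hmd)
  -- Extension by zero preserves the norm, so the moments depend on `α` only through `‖α‖`.
  have hnorm : Real.sqrt (∑ i, β i ^ 2) = ‖α‖ := by
    rw [EuclideanSpace.norm_eq]
    congr 1
    refine (Fintype.sum_of_injective _ hinj _ _ (fun i hi => ?_) fun i => ?_).symm
    · rw [hβ, Function.extend_apply' _ _ _ (fun ⟨a, ha⟩ => hi ⟨a, ha⟩)]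
      simp
    · rw [hβ, hinj.extend_apply, Real.norm_eq_abs, sq_abs]
  rw [charFun_apply, integral_map hX (by fun_prop)]
  refine hasSum_besselMoment hμ0 (by positivity) ?_
  simp only [inner_firstCoords_flightPosition hmd c t _ _ α β hβ]
  have hZ : AEMeasurable (fun ω => c * ∑ k, durations t (τ ω) k *
      ∑ i, β i * sphereCoord (d - 1) (θ k ω) i) P :=
    (Finset.aemeasurable_fun_sum _ fun k _ => (h.aemeasurable_duration k).mul
      (Finset.aemeasurable_fun_sum _ fun i _ =>
        (h.aemeasurable_sphereCoord k i).const_mul _)).const_mul _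
  have hB : ∀ᵐ ω ∂P, |c * ∑ k, durations t (τ ω) k *
      ∑ i, β i * sphereCoord (d - 1) (θ k ω) i| ≤ c * (t * ∑ i, |β i|) := by
    filter_upwards [h.ae_abs_sum_le β] with ω hω
    rw [abs_mul, abs_of_pos hc]
    gcongr
  refine (hasSum_integral_exp_mul_I hZ hB).congr_fun fun N => ?_
  simp only [mul_pow c]
  rw [integral_const_mul, h.integral_sum_pow hd hν ht β hμ, hnorm, ← mul_assoc, ← mul_pow,
    ← mul_assoc]

theorem theorem1 {Ω : Type*} [MeasurableSpace Ω] (P : Measure Ω) [IsProbabilityMeasure P]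
    (n d m : ℕ) (hn : 1 ≤ n) (hd : 2 ≤ d) (hm : 1 ≤ m) (hmd : m < d)
    (ν c t : ℝ) (hν : 0 ≤ ν) (hc : 0 < c) (ht : 0 < t)
    (τ : Ω → Fin n → ℝ) (θ : Fin (n + 1) → Ω → Fin (d - 1) → ℝ)
    (hflight : IsRandomFlight P n d ν t τ θ)
    (X : Ω → EuclideanSpace ℝ (Fin m))
    (hX : X = fun ω => firstCoords hmd.le (flightPosition d c t (τ ω) (fun k => θ k ω)))
    (μ : ℝ) (hμ : μ = ((n : ℝ) + 1) / 2 * (2 * ν + d - 1) - 1 / 2) :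
    (∀ α : EuclideanSpace ℝ (Fin m), α ≠ 0 →
      charFun (P.map X) α =
        ((2 ^ μ * Real.Gamma (μ + 1) / (c * t * ‖α‖) ^ μ * besselJ μ (c * t * ‖α‖) : ℝ) : ℂ)) ∧
    charFun (P.map X) 0 = 1 ∧
    (∀ α β : EuclideanSpace ℝ (Fin m), ‖α‖ = ‖β‖ →
      charFun (P.map X) α = charFun (P.map X) β) := by
  have key : ∀ α : EuclideanSpace ℝ (Fin m), α ≠ 0 →
      charFun (P.map X) α =
        ((2 ^ μ * Real.Gamma (μ + 1) / (c * t * ‖α‖) ^ μ * besselJ μ (c * t * ‖α‖) : ℝ) : ℂ) :=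
    fun α hα => by
      rw [hX]
      exact charFun_firstCoords_flightPosition hd hmd hν hc ht hflight hμ hα
  refine ⟨key, ?_, fun α β hαβ => ?_⟩
  · have hXm : AEMeasurable X P := hX ▸ hflight.aemeasurable_firstCoords hmd c
    have := Measure.isProbabilityMeasure_map hXm
    simp
  · by_cases hα : α = 0
    · have hβ : β = 0 := by rwa [hα, norm_zero, eq_comm, norm_eq_zero] at hαβ
      rw [hα, hβ]
    · have hβ : β ≠ 0 := by rwa [← norm_ne_zero_iff, ← hαβ, norm_ne_zero_iff]
      rw [key α hα, key β hβ, hαβ]
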